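/- Let $d\ge 3$ and let $G$ be a finite simple $d$-regular graph on $n$ vertices (not necessarily connected). Let $\tau(G)$ denote the number of spanning trees of $G$ (labelled, i.e. counted as subgraphs of $G$). Then $$\tau(G)\le \frac{e(d-1)}{d(d-2)}\left(\frac{(d-1)^{d-1}}{(d^2-2d)^{d/2-1}}\right)^n,$$ where $e$ is the base of the natural logarithm. -/

import Mathlib

/-- The number of spanning trees of a simple graph `G`: the number of trees on the whole vertex
set of `G` all of whose edges are edges of `G`. -/
noncomputable def SimpleGraph.numSpanningTrees {V : Type*} (G : SimpleGraph V) : ℕ :=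
  {T : SimpleGraph V | T ≤ G ∧ T.IsTree}.ncard

/-! For every y > 0, the determinant of y + L, with L the Laplacian, is by Cauchy–Binet a
nonnegative sum that contains y for each spanning tree with a chosen root, so y·n·τ(G) ≤ det(y + L)
(`mul_numSpanningTrees_le_det`).

Write y = 1/t + (d-1)t - d with 0 < t < 1/(d-1). By regularity t(y + L) = (1 + (d-1)t²) - tA, with A
the adjacency matrix. The Ihara–Bass factorisation relates its determinant to det(1 - tB), where B
is the non-backtracking operator on darts. Since 1 - tB has unit diagonal, nonpositive off-diagonal
entries and positive row sums, its determinant is at most 1 (`det_pos_and_le_prod_diag`). This gives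
det(y + L) ≤ (t⁻¹(1 - t²)^(1 - d/2))^n.

As a function of y, the logarithm of the base lies below its tangent at y = 0, that is at t =
1/(d-1), of slope a = (d-1)/(d(d-2)) (`log_add_mul_log_le`). The bound is then C^n·exp(a·y·n)/(y·n),
with C the base at y = 0. Taking y·n = 1/a gives the constant e·a. -/

/-! ### Cauchy–Binet and a lower bound for determinants. -/

open Matrix in
/-- A weighted **Cauchy–Binet formula**, with the subsets of columns replaced by functions. -/
theorem Matrix.factorial_mul_det_mul_diagonal_mul_transpose {V M R : Type*} [Fintype V]
    [DecidableEq V] [Fintype M] [DecidableEq M] [CommRing R] (N : Matrix V M R) (w : M → R) :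
    ((Fintype.card V).factorial : R) * (N * diagonal w * Nᵀ).det =
      ∑ f : V → M, (∏ i, w (f i)) * (N.submatrix id f).det ^ 2 := by
  have entry (u v : V) : (N * diagonal w * Nᵀ) u v = ∑ m, w m * (N u m * N v m) := by
    rw [mul_apply]
    simp only [mul_diagonal, transpose_apply]
    exact Finset.sum_congr rfl fun m _ => by ring
  -- Permuting the rows as well and summing over σ produces the factorial and makes the two copies
  -- of `N` symmetric, whence the square.
  have key (σ : Equiv.Perm V) : (((Equiv.Perm.sign σ : ℤ) : R)) * ∑ τ : Equiv.Perm V,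
      ((Equiv.Perm.sign τ : ℤ) : R) * ∏ i, (N * diagonal w * Nᵀ) (σ i) (τ i) =
      (N * diagonal w * Nᵀ).det := by
    have h : ∑ τ : Equiv.Perm V,
      ((Equiv.Perm.sign τ : ℤ) : R) * ∏ i, (N * diagonal w * Nᵀ) (σ i) (τ i) =
        ((N * diagonal w * Nᵀ).submatrix σ id).det := by
      rw [← det_transpose, det_apply']
      rfl
    rw [h, det_permute, ← mul_assoc]
    rcases Int.units_eq_one_or (Equiv.Perm.sign σ) with h | h <;> simp [h]
  calc _ = ∑ σ : Equiv.Perm V, (N * diagonal w * Nᵀ).det := by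
        simp [Fintype.card_perm]
    _ = ∑ σ : Equiv.Perm V, ∑ τ : Equiv.Perm V, ∑ f : V → M, (∏ i, w (f i)) *
          ((((Equiv.Perm.sign σ : ℤ) : R) * ∏ i, N (σ i) (f i)) *
            (((Equiv.Perm.sign τ : ℤ) : R) * ∏ i, N (τ i) (f i))) := by
        refine Finset.sum_congr rfl fun σ _ => ?_
        rw [← key σ, Finset.mul_sum]
        refine Finset.sum_congr rfl fun τ _ => ?_
        simp only [entry]
        rw [Finset.prod_univ_sum, Fintype.piFinset_univ, Finset.mul_sum, Finset.mul_sum]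
        refine Finset.sum_congr rfl fun f _ => ?_
        rw [Finset.prod_mul_distrib, Finset.prod_mul_distrib]
        ring
    _ = ∑ f : V → M, ∑ σ : Equiv.Perm V, ∑ τ : Equiv.Perm V, (∏ i, w (f i)) *
          ((((Equiv.Perm.sign σ : ℤ) : R) * ∏ i, N (σ i) (f i)) *
            (((Equiv.Perm.sign τ : ℤ) : R) * ∏ i, N (τ i) (f i))) := by
        rw [Finset.sum_comm]
        simp_rw [Finset.sum_comm (s := (Finset.univ : Finset (Equiv.Perm V)))
          (t := (Finset.univ : Finset (V → M)))]
        exact Finset.sum_congr rfl fun f _ => Finset.sum_comm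
    _ = _ := by
        refine Finset.sum_congr rfl fun f _ => ?_
        simp_rw [← Finset.mul_sum]
        rw [← Finset.sum_mul, sq, det_apply']
        rfl

-- Each S in 𝒯 is the image of at least |V|! maps V → M. The corresponding minors are nonzero
-- integers, so their squares are at least 1; it is not necessary to know that they are ±1. All
-- other terms are nonnegative and are dropped.
open Matrix in
theorem Matrix.sum_prod_le_det_mul_diagonal_mul_transpose {V M : Type*} [Fintype V]
    [DecidableEq V] [Fintype M] [DecidableEq M] (N : Matrix V M ℤ) (w : M → ℝ)
    (hw : ∀ m, 0 ≤ w m) (𝒯 : Finset (Finset M)) (hcard : ∀ S ∈ 𝒯, S.card = Fintype.card V)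
    (hN : ∀ S ∈ 𝒯, ∀ x : V → ℤ, (∀ m ∈ S, (x ᵥ* N) m = 0) → x = 0) :
    ∑ S ∈ 𝒯, ∏ m ∈ S, w m ≤
      (N.map (Int.cast : ℤ → ℝ) * diagonal w * (N.map (Int.cast : ℤ → ℝ))ᵀ).det := by
  have hpos : (0 : ℝ) < (Fintype.card V).factorial := by positivity
  refine le_of_mul_le_mul_left ?_ hpos
  rw [Matrix.factorial_mul_det_mul_diagonal_mul_transpose, Finset.mul_sum,
    ← Finset.sum_fiberwise (s := Finset.univ) (g := fun f : V → M => Finset.univ.image f)]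
  have term_nonneg (f : V → M) :
      0 ≤ (∏ i, w (f i)) * ((N.map (Int.cast : ℤ → ℝ)).submatrix id f).det ^ 2 :=
    mul_nonneg (Finset.prod_nonneg fun i _ => hw _) (sq_nonneg _)
  refine (Finset.sum_le_sum fun S hS => ?_).trans (Finset.sum_le_sum_of_subset_of_nonneg
    (Finset.subset_univ 𝒯) fun S _ _ => Finset.sum_nonneg fun f _ => term_nonneg f)
  have hfib : (Fintype.card V).factorial ≤
      (Finset.univ.filter fun f : V → M => Finset.univ.image f = S).card := by
    have e : V ≃ S := Fintype.equivOfCardEq (by simp [hcard S hS])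
    rw [← Fintype.card_equiv e, ← Finset.card_univ]
    refine Finset.card_le_card_of_injOn (fun g i => (g i : M)) ?_ ?_
    · intro g _
      simp only [Finset.coe_filter, Finset.mem_univ, true_and, Set.mem_ofPred_eq]
      ext m
      simp only [Finset.mem_image, Finset.mem_univ, true_and]
      constructor
      · rintro ⟨i, rfl⟩
        exact (g i).2
      · intro hm
        exact ⟨g.symm ⟨m, hm⟩, by simp⟩
    · intro g _ g' _ h
      ext i
      exact congrFun h i
  have hprod : 0 ≤ ∏ m ∈ S, w m := Finset.prod_nonneg fun m _ => hw m
  calc ((Fintype.card V).factorial : ℝ) * ∏ m ∈ S, w m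
      ≤ ((Finset.univ.filter fun f : V → M => Finset.univ.image f = S).card : ℝ) *
          ∏ m ∈ S, w m := by gcongr
    _ = ∑ f with Finset.univ.image f = S, ∏ m ∈ S, w m := by
        rw [Finset.sum_const, nsmul_eq_mul]
    _ ≤ _ := by
        refine Finset.sum_le_sum fun f hf => ?_
        rw [Finset.mem_filter] at hf
        have hinj : Function.Injective f := by
          rw [← Set.injOn_univ, ← Finset.coe_univ, ← Finset.card_image_iff, hf.2, hcard S hS,
            Finset.card_univ]
        have hS' : ∏ m ∈ S, w m = ∏ i, w (f i) := by
          rw [← hf.2, Finset.prod_image fun a _ b _ h => hinj h]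
        have hdet : (N.submatrix id f).det ≠ 0 := by
          intro h0
          obtain ⟨x, hx, hx0⟩ := exists_vecMul_eq_zero_iff.2 h0
          refine hx (hN S hS x fun m hm => ?_)
          rw [← hf.2] at hm
          obtain ⟨i, -, rfl⟩ := Finset.mem_image.1 hm
          exact congrFun hx0 i
        have hone : (1 : ℝ) ≤ ((N.map (Int.cast : ℤ → ℝ)).submatrix id f).det ^ 2 := by
          have hc : ((N.map (Int.cast : ℤ → ℝ)).submatrix id f).det =
              ((N.submatrix id f).det : ℝ) := by
            rw [Int.cast_det]
            rfl
          rw [hc]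
          have : 0 < (N.submatrix id f).det ^ 2 := by positivity
          exact_mod_cast this
        rw [hS']
        exact le_mul_of_one_le_right (hS' ▸ hprod) hone

/-! ### Spanning trees and the shifted Laplacian. -/

namespace SimpleGraph

variable {V : Type*}

open Classical in
/-- The columns indexed by `Sum.inl v` are the standard unit vectors, and those indexed by
`Sum.inr e` are the columns of an oriented incidence matrix of `G`. -/
noncomputable def rootedIncMatrix (G : SimpleGraph V) : Matrix V (V ⊕ Sym2 V) ℤ :=
  Matrix.of fun v m => match m with
    | .inl u => if v = u then 1 else 0
    -- `Quot.out` fixes an arbitrary orientation of each edge; columns of non-edges vanish.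
    | .inr e => G.incMatrix ℤ v e * if v = (Quot.out e).1 then 1 else -1

open Matrix in
theorem rootedIncMatrix_mul_diagonal_mul_transpose [Fintype V] [DecidableEq V]
    (G : SimpleGraph V) [DecidableRel G.Adj] (y : ℝ) :
    G.rootedIncMatrix.map (Int.cast : ℤ → ℝ) *
      (diagonal (Sum.elim (fun _ => y) fun _ => 1) : Matrix (V ⊕ Sym2 V) (V ⊕ Sym2 V) ℝ) *
      (G.rootedIncMatrix.map (Int.cast : ℤ → ℝ))ᵀ = y • 1 + G.lapMatrix ℝ := by
  classical
  ext u v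
  rw [mul_apply]
  simp only [mul_diagonal, transpose_apply, map_apply, rootedIncMatrix, of_apply]
  rw [Fintype.sum_sum_type]
  have h1 := congrFun (congrFun (G.incMatrix_mul_transpose (R := ℝ)) u) v
  simp only [mul_apply, transpose_apply, of_apply] at h1
  simp only [Sum.elim_inl, Sum.elim_inr, Matrix.add_apply, Matrix.smul_apply,
    lapMatrix, Matrix.sub_apply, degMatrix,
    adjMatrix_apply, one_apply, diagonal_apply]
  congr 1
  · by_cases h : u = v
    · subst h; simp
    · rw [if_neg h]
      refine (Finset.sum_eq_zero fun x _ => ?_).trans (by simp)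
      by_cases hx : u = x
      · subst hx; simp [Ne.symm h]
      · simp [hx]
  · by_cases h : u = v
    · subst h
      simp only [if_true, G.irrefl, if_false, sub_zero] at h1 ⊢
      rw [← h1]
      refine Finset.sum_congr rfl fun e _ => ?_
      simp only [incMatrix_apply']
      split_ifs <;> simp
    · rw [if_neg h] at h1 ⊢
      rw [zero_sub, ← h1, ← Finset.sum_neg_distrib]
      refine Finset.sum_congr rfl fun e _ => ?_
      simp only [incMatrix_apply']
      by_cases hu : e ∈ G.incidenceSet u <;> by_cases hv : e ∈ G.incidenceSet v <;> simp [hu, hv]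
      have hout : s((Quot.out e).1, (Quot.out e).2) = e := Quot.out_eq e
      have hu' : u ∈ e := hu.2
      have hv' : v ∈ e := hv.2
      rw [← hout, Sym2.mem_iff] at hu' hv'
      grind

open Matrix in
theorem mul_numSpanningTrees_le_det [Fintype V] [DecidableEq V]
    (G : SimpleGraph V) [DecidableRel G.Adj] {y : ℝ} (hy : 0 ≤ y) :
    y * Fintype.card V * G.numSpanningTrees ≤ (y • 1 + G.lapMatrix ℝ).det := by
  classical
  let 𝒮 : Finset (SimpleGraph V) := Finset.univ.filter fun T => T ≤ G ∧ T.IsTree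
  -- A tree with a root v gives n columns: the unit vector at v, of weight y, and the n - 1 edges,
  -- of weight 1. The choice of v accounts for the factor n.
  let S (p : SimpleGraph V × V) : Finset (V ⊕ Sym2 V) :=
    Finset.disjSum {p.2} p.1.edgeFinset
  have hS : Function.Injective S := by
    rintro ⟨T, v⟩ ⟨T', v'⟩ h
    have h' := (Finset.disjSum_inj).1 h
    simpa [and_comm] using h'
  have hτ : G.numSpanningTrees = 𝒮.card := by
    rw [numSpanningTrees, ← Set.ncard_coe_finset]
    congr 1
    ext T
    simp [𝒮]
  have hmain := G.rootedIncMatrix.sum_prod_le_det_mul_diagonal_mul_transpose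
    (Sum.elim (fun _ => y) fun _ => 1) (by rintro (v | e) <;> simp [hy])
    ((𝒮 ×ˢ Finset.univ).image S) ?_ ?_
  · rw [rootedIncMatrix_mul_diagonal_mul_transpose,
      Finset.sum_image fun a _ b _ h => hS h] at hmain
    refine le_trans (le_of_eq ?_) hmain
    simp [S, Finset.prod_disjSum, hτ]
    ring
  · intro X hX
    obtain ⟨⟨T, v⟩, hT, rfl⟩ := Finset.mem_image.1 hX
    simp only [Finset.mem_product, 𝒮, Finset.mem_filter, Finset.mem_univ, true_and, and_true] at hT
    simp only [S]
    rw [Finset.card_disjSum, Finset.card_singleton, add_comm, hT.2.card_edgeFinset]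
  · intro X hX x hx
    obtain ⟨⟨T, v⟩, hT, rfl⟩ := Finset.mem_image.1 hX
    simp only [Finset.mem_product, 𝒮, Finset.mem_filter, Finset.mem_univ, true_and, and_true] at hT
    -- The root column forces x to vanish at v and the edge columns force x to be constant along the
    -- tree.
    have hv : x v = 0 := by
      simpa [vecMul, dotProduct, rootedIncMatrix] using
        hx (.inl v) (by simp [S])
    have hout (e : Sym2 V) (he : e ∈ T.edgeSet) : x (Quot.out e).1 = x (Quot.out e).2 := by
      have h := hx (.inr e) (by simpa [S] using he)
      have heq : s((Quot.out e).1, (Quot.out e).2) = e := Quot.out_eq e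
      have hadj : T.Adj (Quot.out e).1 (Quot.out e).2 := by rwa [← mem_edgeSet, heq]
      have heG : e ∈ G.edgeSet := edgeSet_mono hT.1 he
      have hinc (u : V) : e ∈ G.incidenceSet u ↔ u = (Quot.out e).1 ∨ u = (Quot.out e).2 := by
        rw [← Sym2.mem_iff, heq]
        exact ⟨fun h => h.2, fun h => ⟨heG, h⟩⟩
      simp only [vecMul, dotProduct, rootedIncMatrix, of_apply, incMatrix_apply', hinc] at h
      rw [Finset.sum_eq_add (Quot.out e).1 (Quot.out e).2 hadj.ne] at h
      · simp [hadj.ne.symm] at h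
        linarith
      · intro u _ hu
        simp [hu.1, hu.2]
      · simp
      · simp
    have hadj (a b : V) (h : T.Adj a b) : x a = x b := by
      have := hout s(a, b) h
      have heq : s((Quot.out s(a, b)).1, (Quot.out s(a, b)).2) = s(a, b) := Quot.out_eq _
      rcases Sym2.eq_iff.1 heq with h | h <;> rw [h.1, h.2] at this <;> simp [this]
    funext u
    obtain ⟨p⟩ := hT.2.connected.preconnected u v
    induction p with
    | nil => exact hv
    | cons h p ih => rw [hadj _ _ h]; exact ih hX hx hv

end SimpleGraph

/-! ### Determinants of diagonally dominant matrices with nonpositive off-diagonal entries. -/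

open Matrix in
/-- A matrix with nonpositive off-diagonal entries and positive row sums has a positive
determinant, which is at most the product of the diagonal entries. -/
theorem Matrix.det_pos_and_le_prod_diag_fin : ∀ (n : ℕ) (A : Matrix (Fin n) (Fin n) ℝ),
    (∀ i j, i ≠ j → A i j ≤ 0) → (∀ i, 0 < ∑ j, A i j) →
    (∀ i, 0 < A i i) ∧ 0 < A.det ∧ A.det ≤ ∏ i, A i i := by
  intro n
  induction n with
  | zero => intro A _ _; simp
  | succ n ih =>
    intro A hoff hrow
    have hdiag (i : Fin (n + 1)) : 0 < A i i := by
      have h := hrow i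
      rw [← Finset.add_sum_erase _ _ (Finset.mem_univ i)] at h
      have := Finset.sum_nonpos fun j (hj : j ∈ Finset.univ.erase i) =>
        hoff i j (Finset.ne_of_mem_erase hj).symm
      linarith
    -- Multipliers of one step of Gaussian elimination. As they are nonnegative, the remaining block
    -- keeps positive row sums, while its entries can only decrease.
    set c : Fin (n + 1) → ℝ := fun i => if i = 0 then 0 else -(A i 0 / A 0 0) with hc
    have hc0 (i : Fin (n + 1)) : 0 ≤ c i := by
      by_cases h : i = 0
      · simp [hc, h]
      · simp only [hc, h, if_false, Left.nonneg_neg_iff]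
        exact div_nonpos_of_nonpos_of_nonneg (hoff i 0 h) (hdiag 0).le
    let C : Matrix (Fin (n + 1)) (Fin (n + 1)) ℝ := of fun i j => A i j + c i * A 0 j
    have hCdet : C.det = A.det :=
      det_eq_of_forall_row_eq_smul_add_const c 0 (by simp [hc]) fun i j => rfl
    have hC0 (i : Fin n) : C i.succ 0 = 0 := by
      simp [C, hc, Fin.succ_ne_zero, (hdiag 0).ne']
    have hC00 : C 0 0 = A 0 0 := by simp [C, hc]
    have hexp : C.det = A 0 0 * (C.submatrix Fin.succ Fin.succ).det := by
      rw [det_succ_column_zero, Fin.sum_univ_succ]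
      simp [hC0, hC00]
    have hCle (i j : Fin n) : C i.succ j.succ ≤ A i.succ j.succ := by
      have := mul_nonpos_of_nonneg_of_nonpos (hc0 i.succ) (hoff 0 j.succ (Fin.succ_ne_zero j).symm)
      simp only [C, of_apply]
      linarith
    obtain ⟨h1, h2, h3⟩ := ih (C.submatrix Fin.succ Fin.succ)
      (fun i j hij => (hCle i j).trans (hoff _ _ fun h => hij (Fin.succ_injective _ h)))
      (fun i => by
        have hs : ∑ j, C i.succ j = ∑ j, A i.succ j + c i.succ * ∑ j, A 0 j := by
          simp [C, Finset.sum_add_distrib, Finset.mul_sum]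
        rw [Fin.sum_univ_succ, hC0, zero_add] at hs
        simp only [submatrix_apply, hs]
        have := mul_nonneg (hc0 i.succ) (hrow 0).le
        linarith [hrow i.succ])
    refine ⟨hdiag, ?_, ?_⟩
    · rw [← hCdet, hexp]
      exact mul_pos (hdiag 0) h2
    · rw [← hCdet, hexp, Fin.prod_univ_succ]
      refine mul_le_mul_of_nonneg_left (h3.trans ?_) (hdiag 0).le
      exact Finset.prod_le_prod (fun i _ => (h1 i).le) fun i _ => hCle i i

theorem Matrix.det_pos_and_le_prod_diag {ι : Type*} [Fintype ι] [DecidableEq ι]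
    (A : Matrix ι ι ℝ) (hoff : ∀ i j, i ≠ j → A i j ≤ 0) (hrow : ∀ i, 0 < ∑ j, A i j) :
    0 < A.det ∧ A.det ≤ ∏ i, A i i := by
  let e := Fintype.equivFin ι
  have h := Matrix.det_pos_and_le_prod_diag_fin _ (A.submatrix e.symm e.symm)
    (fun i j hij => hoff _ _ (e.symm.injective.ne hij))
    (fun i => by
      simpa only [submatrix_apply, Equiv.sum_comp e.symm fun j => A (e.symm i) j] using hrow _)
  rw [det_submatrix_equiv_self] at h
  refine ⟨h.2.1, h.2.2.trans_eq ?_⟩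
  exact Equiv.prod_comp e.symm fun i => A i i

/-! ### Dart matrices and the Ihara–Bass inequality. -/

namespace SimpleGraph

open Matrix

variable {V : Type*} [Fintype V] [DecidableEq V] (G : SimpleGraph V) [DecidableRel G.Adj]

/-- The incidence matrix between vertices and the darts starting at them. -/
def dartFstMatrix : Matrix V G.Dart ℝ := of fun v e => if e.fst = v then 1 else 0

/-- The incidence matrix between vertices and the darts ending at them. -/
def dartSndMatrix : Matrix V G.Dart ℝ := of fun v e => if e.snd = v then 1 else 0

/-- The permutation matrix of the reversal of darts. -/
def dartSymmMatrix : Matrix G.Dart G.Dart ℝ := of fun e f => if f = e.symm then 1 else 0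

theorem dartSymmMatrix_mul_self : G.dartSymmMatrix * G.dartSymmMatrix = 1 := by
  ext e f
  simp only [mul_apply, dartSymmMatrix, of_apply, one_apply, ite_mul, one_mul, zero_mul,
    Finset.sum_ite_eq', Finset.mem_univ, if_true, Dart.symm_symm]
  exact if_congr eq_comm rfl rfl

theorem dartFstMatrix_mul_dartSymmMatrix :
    G.dartFstMatrix * G.dartSymmMatrix = G.dartSndMatrix := by
  ext v f
  have h (e : G.Dart) : f = e.symm ↔ e = f.symm :=
    ⟨fun h => by simp [h], fun h => by simp [h]⟩
  simp [mul_apply, dartSymmMatrix, dartFstMatrix, dartSndMatrix, h]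

theorem dartFstMatrix_mul_dartSndMatrix_transpose :
    G.dartFstMatrix * G.dartSndMatrixᵀ = G.adjMatrix ℝ := by
  ext u v
  simp only [mul_apply, dartFstMatrix, dartSndMatrix, of_apply, transpose_apply, adjMatrix_apply,
    ite_mul, one_mul, zero_mul, ← ite_and]
  split_ifs with h
  · rw [Finset.sum_eq_single ⟨(u, v), h⟩]
    · simp
    · intro e _ he
      rw [if_neg]
      rintro ⟨rfl, rfl⟩
      exact he rfl
    · simp
  · refine Finset.sum_eq_zero fun e _ => if_neg ?_
    rintro ⟨rfl, rfl⟩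
    exact h e.adj

variable {G} {d : ℕ}

omit [DecidableEq V] in
theorem IsRegularOfDegree.card_dart (hG : G.IsRegularOfDegree d) :
    Fintype.card G.Dart = Fintype.card V * d := by
  rw [dart_card_eq_sum_degrees, Finset.sum_congr rfl fun v _ => hG.degree_eq v]
  simp

theorem IsRegularOfDegree.sum_dart_fst (hG : G.IsRegularOfDegree d) (v : V) :
    ∑ e : G.Dart, (if e.fst = v then (1 : ℝ) else 0) = d := by
  rw [Finset.sum_boole, G.dart_fst_fiber_card_eq_degree, hG.degree_eq]

theorem IsRegularOfDegree.dartSndMatrix_mul_transpose (hG : G.IsRegularOfDegree d) :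
    G.dartSndMatrix * G.dartSndMatrixᵀ = (d : ℝ) • 1 := by
  ext u v
  have h := hG.sum_dart_fst v
  rw [← Equiv.sum_comp (Function.Involutive.toPerm _ (Dart.symm_involutive (G := G)))] at h
  simp only [mul_apply, dartSndMatrix, of_apply, transpose_apply, Matrix.smul_apply, one_apply,
    smul_eq_mul, mul_ite, mul_one, mul_zero]
  by_cases huv : u = v
  · subst huv
    rw [if_pos rfl, ← h]
    refine Finset.sum_congr rfl fun e _ => ?_
    simp
  · rw [if_neg huv]
    refine Finset.sum_eq_zero fun e _ => ?_
    split_ifs with h1 h2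
    · exact absurd (h2.symm.trans h1) huv
    · rfl
    · rfl

-- Fixes the sign when the square root of `det_one_add_smul_dartSymmMatrix_sq` is taken.
variable (G) in
theorem det_one_sub_smul_dartSymmMatrix_pos {t : ℝ} (h0 : 0 ≤ t) (h1 : t < 1) :
    0 < (1 - t • G.dartSymmMatrix).det := by
  refine (det_pos_and_le_prod_diag _ (fun i j hij => ?_) fun i => ?_).1
  · simp only [Matrix.sub_apply, one_apply_ne hij, Matrix.smul_apply, dartSymmMatrix, of_apply, smul_eq_mul]
    split_ifs <;> simp [h0]
  · simp [Matrix.sub_apply, dartSymmMatrix, one_apply, h1]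

-- Give each dart a sign that changes under reversal. Conjugation by the diagonal matrix of these
-- signs negates the reversal matrix.
variable (G) in
theorem det_one_add_smul_dartSymmMatrix (t : ℝ) :
    (1 + t • G.dartSymmMatrix).det = (1 - t • G.dartSymmMatrix).det := by
  let ε (e : G.Dart) : ℝ :=
    if Fintype.equivFin V e.fst < Fintype.equivFin V e.snd then 1 else -1
  have hε (e : G.Dart) : ε e * ε e = 1 := by
    simp only [ε]; split_ifs <;> simp
  have hεs (e : G.Dart) : ε e * ε e.symm = -1 := by
    have : Fintype.equivFin V e.fst ≠ Fintype.equivFin V e.snd := by simp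
    simp only [ε, Dart.symm, Prod.fst_swap, Prod.snd_swap]
    rcases lt_or_gt_of_ne this with h | h <;> simp [h, h.not_gt]
  have hconj : diagonal ε * (1 + t • G.dartSymmMatrix) * diagonal ε =
      1 - t • G.dartSymmMatrix := by
    ext e f
    rw [mul_diagonal, diagonal_mul]
    simp only [Matrix.add_apply, Matrix.sub_apply, Matrix.smul_apply, dartSymmMatrix, of_apply, one_apply, smul_eq_mul]
    have hne := e.symm_ne
    by_cases hef : e = f
    · subst hef
      simp [hne.symm, hε]
    · by_cases hfe : f = e.symm
      · subst hfe
        have := hεs e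
        simp [hne.symm]
        linear_combination t * this
      · simp [hef, hfe]
  have hdet : (diagonal ε).det * (diagonal ε).det = 1 := by
    rw [← det_mul, diagonal_mul_diagonal]
    simp [hε]
  rw [← hconj, det_mul, det_mul]
  linear_combination (-(1 + t • G.dartSymmMatrix).det) * hdet

variable (G) in
theorem one_add_mul_one_sub_smul_dartSymmMatrix (t : ℝ) :
    (1 + t • G.dartSymmMatrix) * (1 - t • G.dartSymmMatrix) = (1 - t ^ 2) • 1 := by
  have h := G.dartSymmMatrix_mul_self
  rw [add_mul, one_mul, Matrix.smul_mul, mul_sub, mul_one, Matrix.mul_smul, h, sub_smul, one_smul,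
    sq, mul_smul, smul_sub]
  abel

theorem IsRegularOfDegree.det_one_add_smul_dartSymmMatrix_sq (hG : G.IsRegularOfDegree d) (t : ℝ) :
    (1 + t • G.dartSymmMatrix).det ^ 2 = (1 - t ^ 2) ^ (Fintype.card V * d) := by
  rw [← hG.card_dart, sq]
  nth_rw 2 [det_one_add_smul_dartSymmMatrix]
  rw [← det_mul, one_add_mul_one_sub_smul_dartSymmMatrix, det_smul, det_one, mul_one]

/-- An inequality form of the **Ihara–Bass formula**: up to a power of `1 - t ^ 2`, the left-hand
side is the reciprocal of the Ihara zeta function of a regular graph. -/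
theorem IsRegularOfDegree.det_mul_det_le (hG : G.IsRegularOfDegree d) {t : ℝ} (h0 : 0 ≤ t)
    (h1 : t < 1) (ht : t * (d - 1) < 1) :
    ((1 + (d - 1) * t ^ 2) • 1 - t • G.adjMatrix ℝ).det * (1 + t • G.dartSymmMatrix).det ≤
      (1 - t ^ 2) ^ Fintype.card V := by
  have hq : 0 < 1 - t ^ 2 := by nlinarith
  set J := G.dartSymmMatrix
  set S := G.dartFstMatrix
  set T := G.dartSndMatrix
  -- `Tᵀ * S` records which darts can follow one another, and subtracting `J` removes backtracking:
  -- the matrix is 1 - tB, with row sums 1 - t(d-1).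
  have hK : (1 + t • J - t • (Tᵀ * S)).det ≤ 1 := by
    have hTS (e f : G.Dart) : (Tᵀ * S) e f = if f.fst = e.snd then 1 else 0 := by
      simp [T, S, mul_apply, dartFstMatrix, dartSndMatrix, eq_comm]
    refine (det_pos_and_le_prod_diag _ (fun e f hef => ?_) fun e => ?_).2.trans_eq ?_
    · simp only [Matrix.sub_apply, Matrix.add_apply, one_apply_ne hef, Matrix.smul_apply, hTS, J, dartSymmMatrix,
        of_apply, smul_eq_mul]
      by_cases h : f = e.symm
      · subst h; simp
      · simp only [h, if_false]; split_ifs <;> simp [h0]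
    · simp only [Matrix.sub_apply, Matrix.add_apply, Matrix.smul_apply, hTS, smul_eq_mul, Finset.sum_sub_distrib,
        Finset.sum_add_distrib, ← Finset.mul_sum, hG.sum_dart_fst]
      simp [J, dartSymmMatrix, one_apply]
      linarith
    · refine Finset.prod_eq_one fun e _ => ?_
      simp [hTS, J, dartSymmMatrix, e.symm_ne.symm]
  -- Here (1 + tJ)⁻¹ = (1 - tJ)/(1 - t²). Once 1 + tJ is factored out, det(1 - XY) = det(1 - YX)
  -- passes from darts to vertices.
  have hfac : 1 + t • J - t • (Tᵀ * S) =
      (1 + t • J) * (1 - ((t / (1 - t ^ 2)) • ((1 - t • J) * Tᵀ)) * S) := by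
    rw [mul_sub, mul_one, Matrix.smul_mul, Matrix.mul_smul, Matrix.mul_assoc,
      ← Matrix.mul_assoc (1 + t • J), one_add_mul_one_sub_smul_dartSymmMatrix, Matrix.smul_mul,
      Matrix.one_mul, smul_smul,
      div_mul_cancel₀ _ hq.ne']
  have hST : S * ((t / (1 - t ^ 2)) • ((1 - t • J) * Tᵀ)) =
      (t / (1 - t ^ 2)) • (G.adjMatrix ℝ - (t * d) • 1) := by
    rw [Matrix.mul_smul, Matrix.sub_mul, Matrix.one_mul, Matrix.mul_sub,
      dartFstMatrix_mul_dartSndMatrix_transpose, Matrix.smul_mul, Matrix.mul_smul, ← Matrix.mul_assoc, dartFstMatrix_mul_dartSymmMatrix,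
      hG.dartSndMatrix_mul_transpose, smul_smul]
  have hmat : (1 + (d - 1) * t ^ 2) • 1 - t • G.adjMatrix ℝ =
      (1 - t ^ 2) • (1 - (t / (1 - t ^ 2)) • (G.adjMatrix ℝ - (t * d) • (1 : Matrix V V ℝ))) := by
    ext u v
    simp only [Matrix.sub_apply, Matrix.smul_apply, smul_eq_mul]
    field_simp
    ring
  rw [hfac, det_mul, det_one_sub_mul_comm, hST] at hK
  rw [hmat, det_smul]
  have := mul_le_mul_of_nonneg_left hK (pow_pos hq (Fintype.card V)).le
  linarith

end SimpleGraph

/-! ### Real analysis in the parameter t. -/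

/-- With y = 1/t + (d-1)t - d, the derivative of the left side with respect to y is t/(1 - t²). It
is largest at t₀ = 1/(d-1), where it equals a; so the left side minus a·y increases on (0, t₀], and
y vanishes at t₀. -/
theorem log_add_mul_log_le {d t : ℝ} (hd : 2 < d) (h0 : 0 < t) (ht : t ≤ 1 / (d - 1)) :
    -Real.log t + (1 - d / 2) * Real.log (1 - t ^ 2) ≤
      -Real.log (1 / (d - 1)) + (1 - d / 2) * Real.log (1 - (1 / (d - 1)) ^ 2) +
        (d - 1) / (d * (d - 2)) * (1 / t + (d - 1) * t - d) := by
  set a := (d - 1) / (d * (d - 2)) with ha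
  set t₀ := 1 / (d - 1) with ht₀
  have hd1 : 0 < d - 1 := by linarith
  have ht₀1 : t₀ < 1 := by rw [ht₀, div_lt_one hd1]; linarith
  have hmul : t₀ * (d - 1) = 1 := by rw [ht₀]; field_simp
  have hat : a * (1 - t₀ ^ 2) = t₀ := by
    rw [ha, ht₀]
    have : d - 2 ≠ 0 := by linarith
    field_simp
    ring
  have hapos : 0 < a := by
    rw [ha]; exact div_pos hd1 (mul_pos (by linarith) (by linarith))
  let h (s : ℝ) : ℝ :=
    -Real.log s + (1 - d / 2) * Real.log (1 - s ^ 2) - a * (1 / s + (d - 1) * s - d)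
  have hderiv (s : ℝ) (hs0 : 0 < s) (hs : s ≤ t₀) : HasDerivAt h
      (-s⁻¹ + (1 - d / 2) * (-(2 * s) / (1 - s ^ 2)) - a * (-(s ^ 2)⁻¹ + (d - 1))) s := by
    have hq : 1 - s ^ 2 ≠ 0 := by nlinarith
    have e1 := (Real.hasDerivAt_log hs0.ne').neg
    have e2 : HasDerivAt (fun s : ℝ => 1 - s ^ 2) (-(2 * s)) s := by
      simpa using ((hasDerivAt_id s).pow 2).const_sub 1
    have e3 := (e2.log hq).const_mul (1 - d / 2)
    have e4 : HasDerivAt (fun s : ℝ => 1 / s + (d - 1) * s - d) (-(s ^ 2)⁻¹ + (d - 1)) s := by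
      simpa using ((hasDerivAt_inv hs0.ne').add ((hasDerivAt_id s).const_mul (d - 1))).sub_const d
    exact (e1.add e3).sub (e4.const_mul a)
  have hmono : MonotoneOn h (Set.Icc t t₀) := by
    refine monotoneOn_of_deriv_nonneg (convex_Icc _ _) (fun s hs =>
      (hderiv s (h0.trans_le hs.1) hs.2).continuousAt.continuousWithinAt) (fun s hs => ?_)
      fun s hs => ?_ <;> rw [interior_Icc] at hs
    · exact (hderiv s (h0.trans hs.1) hs.2.le).differentiableAt.differentiableWithinAt
    · have hs0 := h0.trans hs.1
      have hs1 := hs.2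
      rw [(hderiv s hs0 hs1.le).deriv]
      have hq : 0 < 1 - s ^ 2 := by nlinarith
      have hq' : 0 ≤ 1 - (d - 1) * s ^ 2 := by
        have : (d - 1) * s ≤ 1 := by nlinarith
        nlinarith
      have hr : 0 ≤ a * (1 - s ^ 2) - s := by
        have : a * (1 - t₀ ^ 2) ≤ a * (1 - s ^ 2) := by gcongr
        linarith
      have : -s⁻¹ + (1 - d / 2) * (-(2 * s) / (1 - s ^ 2)) - a * (-(s ^ 2)⁻¹ + (d - 1)) =
          (1 - (d - 1) * s ^ 2) * (a * (1 - s ^ 2) - s) / (s ^ 2 * (1 - s ^ 2)) := by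
        field_simp
        ring
      rw [this]
      positivity
  have hle := hmono ⟨le_rfl, ht⟩ ⟨ht, le_rfl⟩ ht
  have hz : 1 / t₀ + (d - 1) * t₀ - d = 0 := by
    rw [ht₀]; field_simp; ring
  simp only [h, hz] at hle
  linarith

theorem exists_one_div_add_mul_sub_eq {d y : ℝ} (hd : 2 < d) (hy : 0 < y) :
    ∃ t, 0 < t ∧ t < 1 / (d - 1) ∧ 1 / t + (d - 1) * t - d = y := by
  have hd1 : 0 < d - 1 := by linarith
  have hx : 0 < d + y := by linarith
  -- At t = 1/(d + y) the terms 1/t - d already give y, so the value there exceeds y; at 1/(d-1) it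
  -- is 0.
  have hle : 1 / (d + y) ≤ 1 / (d - 1) := one_div_le_one_div_of_le hd1 (by linarith)
  have hcont : ContinuousOn (fun t : ℝ => 1 / t + (d - 1) * t - d)
      (Set.Icc (1 / (d + y)) (1 / (d - 1))) := by
    have hne : ∀ t ∈ Set.Icc (1 / (d + y)) (1 / (d - 1)), t ≠ 0 := fun t ht =>
      ((one_div_pos.2 hx).trans_le ht.1).ne'
    fun_prop (disch := assumption)
  have hz : 1 / (1 / (d - 1)) + (d - 1) * (1 / (d - 1)) - d = 0 := by field_simp; ring
  have hmem : y ∈ Set.Icc (1 / (1 / (d - 1)) + (d - 1) * (1 / (d - 1)) - d)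
      (1 / (1 / (d + y)) + (d - 1) * (1 / (d + y)) - d) := by
    rw [hz, one_div_one_div]
    refine ⟨hy.le, ?_⟩
    have : 0 < (d - 1) * (1 / (d + y)) := by positivity
    linarith
  obtain ⟨t, ht, hty⟩ := intermediate_value_Icc' hle hcont hmem
  refine ⟨t, (one_div_pos.2 hx).trans_le ht.1, lt_of_le_of_ne ht.2 ?_, hty⟩
  rintro rfl
  exact hy.ne (hz.symm.trans hty)

theorem exp_log_eq_div_rpow {d : ℕ} (hd : 3 ≤ d) :
    Real.exp (-Real.log (1 / ((d : ℝ) - 1)) +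
      (1 - (d : ℝ) / 2) * Real.log (1 - (1 / ((d : ℝ) - 1)) ^ 2)) =
      ((d : ℝ) - 1) ^ (d - 1) / ((d : ℝ) ^ 2 - 2 * (d : ℝ)) ^ ((d : ℝ) / 2 - 1) := by
  have hd3 : (3 : ℝ) ≤ d := by exact_mod_cast hd
  have hd1 : (0 : ℝ) < d - 1 := by linarith
  have hp : (0 : ℝ) < (d : ℝ) ^ 2 - 2 * d := by nlinarith
  have h1 : 1 - (1 / ((d : ℝ) - 1)) ^ 2 = ((d : ℝ) ^ 2 - 2 * d) / ((d : ℝ) - 1) ^ 2 := by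
    field_simp; ring
  have hpow : ((d : ℝ) - 1) ^ (d - 1) = Real.exp (((d : ℝ) - 1) * Real.log ((d : ℝ) - 1)) := by
    rw [← Real.rpow_natCast, Real.rpow_def_of_pos hd1, Nat.cast_sub (by omega), mul_comm]
    simp
  rw [h1, Real.log_div hp.ne' (by positivity), Real.log_pow, hpow, Real.rpow_def_of_pos hp,
    ← Real.exp_sub, one_div, Real.log_inv]
  congr 1
  push_cast
  ring

/-! ### The spanning tree bound. -/

theorem theorem14 {V : Type*} [Fintype V] (G : SimpleGraph V) [DecidableRel G.Adj]
    (d n : ℕ) (hd : 3 ≤ d) (hn : Fintype.card V = n) (hG : G.IsRegularOfDegree d) :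
    (G.numSpanningTrees : ℝ) ≤
      Real.exp 1 * ((d : ℝ) - 1) / ((d : ℝ) * ((d : ℝ) - 2)) *
        (((d : ℝ) - 1) ^ (d - 1) / ((d : ℝ) ^ 2 - 2 * (d : ℝ)) ^ ((d : ℝ) / 2 - 1)) ^ n := by
  classical
  subst hn
  have hd3 : (3 : ℝ) ≤ d := by exact_mod_cast hd
  have hd1 : (0 : ℝ) < d - 1 := by linarith
  have hd2 : (0 : ℝ) < d - 2 := by linarith
  rw [← exp_log_eq_div_rpow hd]
  rcases isEmpty_or_nonempty V with hV | hV
  · have : G.numSpanningTrees = 0 := by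
      rw [SimpleGraph.numSpanningTrees, Set.ncard_eq_zero]
      ext T
      simp only [Set.mem_ofPred_eq, Set.mem_empty_iff_false, iff_false, not_and]
      exact fun _ hT => not_nonempty_iff.2 hV hT.connected.nonempty
    rw [this, Nat.cast_zero]
    positivity
  have hn : (0 : ℝ) < Fintype.card V := by exact_mod_cast Fintype.card_pos
  set n := Fintype.card V
  -- This value minimises exp(a·y·n)/(y·n): it makes a·y·n = 1, which is the source of the factor e.
  set y : ℝ := d * (d - 2) / ((d - 1) * n) with hy
  have hypos : 0 < y := by positivity
  obtain ⟨t, ht0, ht, hty⟩ := exists_one_div_add_mul_sub_eq (d := d) (by linarith) hypos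
  have htd : t * (d - 1) < 1 := (lt_div_iff₀ hd1).1 ht
  have ht1 : t < 1 := by nlinarith
  have hq : 0 < 1 - t ^ 2 := by nlinarith
  have htree := G.mul_numSpanningTrees_le_det hypos.le
  have hbass := hG.det_mul_det_le ht0.le ht1 htd
  have hs0 := G.det_one_sub_smul_dartSymmMatrix_pos ht0.le ht1
  rw [← G.det_one_add_smul_dartSymmMatrix] at hs0
  have hs := hG.det_one_add_smul_dartSymmMatrix_sq t
  set s := (1 + t • G.dartSymmMatrix).det
  have hs' : s = Real.exp (n * (d / 2 * Real.log (1 - t ^ 2))) := by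
    refine (sq_eq_sq₀ hs0.le (Real.exp_pos _).le).1 ?_
    rw [hs, ← Real.exp_nat_mul, ← Real.exp_log (pow_pos hq _), Real.log_pow]
    congr 1
    push_cast
    ring
  -- Regularity enters as L = d - A, together with 1 + (d-1)t² = t(y + d).
  have hmat : (1 + ((d : ℝ) - 1) * t ^ 2) • 1 - t • G.adjMatrix ℝ =
      t • (y • 1 + G.lapMatrix ℝ) := by
    have hdeg : G.degMatrix ℝ = (d : ℝ) • 1 := by
      rw [SimpleGraph.degMatrix, Matrix.smul_one_eq_diagonal]
      congr 1
      funext v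
      rw [hG.degree_eq]
    have hc : 1 + ((d : ℝ) - 1) * t ^ 2 = t * (y + d) := by
      rw [← hty]; field_simp; ring
    rw [SimpleGraph.lapMatrix, hdeg, hc, smul_add, smul_sub, smul_smul, smul_smul, mul_add,
      add_smul]
    abel
  rw [hmat, Matrix.det_smul] at hbass
  set D := (y • 1 + G.lapMatrix ℝ).det
  set τ := (G.numSpanningTrees : ℝ)
  have hD : D ≤ Real.exp (-Real.log t + (1 - (d : ℝ) / 2) * Real.log (1 - t ^ 2)) ^ n := by
    have h1 : D ≤ (1 - t ^ 2) ^ n / (t ^ n * s) := by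
      rw [le_div_iff₀ (by positivity)]
      linarith
    refine h1.trans_eq ?_
    rw [hs', ← Real.exp_nat_mul, ← Real.exp_log (pow_pos ht0 n), ← Real.exp_log (pow_pos hq n),
      ← Real.exp_add, ← Real.exp_sub, Real.log_pow, Real.log_pow]
    congr 1
    ring
  have hlog := log_add_mul_log_le (d := d) (by linarith) ht0 ht.le
  set E := -Real.log (1 / ((d : ℝ) - 1)) +
      (1 - (d : ℝ) / 2) * Real.log (1 - (1 / ((d : ℝ) - 1)) ^ 2)
  have hE : D ≤ Real.exp 1 * Real.exp E ^ n := by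
    refine (hD.trans (pow_le_pow_left₀ (Real.exp_pos _).le (Real.exp_le_exp.2 hlog) n)).trans_eq ?_
    rw [Real.exp_add, mul_pow, mul_comm, ← Real.exp_nat_mul, hty, hy]
    congr 2
    field_simp
  have hyn : y * n = d * (d - 2) / (d - 1) := by rw [hy]; field_simp
  have hfin := htree.trans hE
  rw [hyn] at hfin
  rw [show Real.exp 1 * ((d : ℝ) - 1) / (d * (d - 2)) * Real.exp E ^ n =
    Real.exp 1 * Real.exp E ^ n / (d * (d - 2) / (d - 1)) by field_simp,
    le_div_iff₀ (by positivity)]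
  linarith
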